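/- **Setting.** Let $\Omega=\prod_{i=1}^d(0,L_i)\subset\mathbb R^d$ with all $L_i>0$, with periodic boundary conditions, let $\varepsilon>0$, $f(s)=s^3-s$, and let $(\cdot,\cdot)$, $\|\cdot\|$ be the inner product and norm of the real space $L^2(\Omega)$. Let $0=t_0<t_1<\dots<t_N=T$, $\tau_k=t_k-t_{k-1}$ for $1\le k\le N$, $r_k=\tau_k/\tau_{k-1}$ for $2\le k\le N$, and $\nabla_\tau v^k=v^k-v^{k-1}$. Define $$D_3v^n=\sum_{k=1}^n b^{(n)}_{n-k}\nabla_\tau v^k ,\qquad n\ge1,$$ where $b_0^{(1)}=\frac1{\tau_1}$; $b_0^{(2)}=\frac{1+2r_2}{\tau_2(1+r_2)}$, $b_1^{(2)}=-\frac{r_2^2}{\tau_2(1+r_2)}$; and, for $n\ge3$, with $\delta_n=\tau_n(1+r_n)(1+r_{n-1})(1+r_{n-1}+r_nr_{n-1})$, $$b_0^{(n)}=\frac{(1+r_{n-1})\left[1+2r_n+r_{n-1}(1+4r_n+3r_n^2)\right]}{\delta_n},\quad b_1^{(n)}=-\frac{r_n^2\left[(1+2r_{n-1}+r_nr_{n-1})^2-r_{n-1}(1+r_{n-1})\right]}{\delta_n},\quad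 b_2^{(n)}=\frac{r_n^2r_{n-1}^3(1+r_n)^2}{\delta_n},$$ and all other $b^{(n)}_j$ vanish. The variable-step BDF3 scheme for the Allen–Cahn equation is $$D_3u^n-\varepsilon^2\Delta u^n+f(u^n)=0,\qquad 1\le n\le N,\qquad u^0=u_0 .\tag{S}$$ Let $V=H^1_{\rm per}(\Omega)\cap L^4(\Omega)$. A solution of step $n$ of (S), for given earlier levels, is a function $u^n\in V$ that satisfies (S) in the weak sense: $(D_3u^n,\psi)+\varepsilon^2(\nabla u^n,\nabla\psi)+\int_\Omega f(u^n)\psi\,dx=0$ for all $\psi\in V$. For $1\le n\le N$ consider the step-size condition $$\tau_n<\frac{1+2r_n+r_{n-1}(1+4r_n+3r_n^2)}{(1+r_n)(1+r_{n-1}+r_nr_{n-1})},\tag{C}$$ where $r_1$ and $r_0$ are read as $0$ (so (C) is $\tau_1<1$ for $n=1$ and $\tau_2<\frac{1+2r_2}{1+r_2}$ for $n=2$). **Theorem 4.1.** (i) For each $1\le n\le N$, condition (C) is equivalent to $b_0^{(n)}>1$. (ii) Let $1\le n\le N$ and suppose (C) holds for $n$. Then for all $u^0,\dots,u^{n-1}\in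 L^2(\Omega)$, step $n$ of (S) has exactly one solution $u^n\in V$. Its distributional Laplacian (with smooth periodic test functions) is an integrable function, and (S) holds almost everywhere in $\Omega$. Moreover the functional $$G[z]=\frac{b_0^{(n)}}2\|z-u^{n-1}\|^2+\Big(\sum_{k=1}^{n-1}b_{n-k}^{(n)}\nabla_\tau u^{k},\,z-u^{n-1}\Big)+\frac{\varepsilon^2}2\|\nabla z\|^2+\frac14\|z^2-1\|^2$$ is strictly convex on $V$, and an element of $V$ solves step $n$ if and only if it is the unique minimizer of $G$ over $V$. (iii) If (C) holds for all $1\le n\le N$, then for every $u_0\in L^2(\Omega)$ there is exactly one sequence $u^0,u^1,\dots,u^N$ with $u^0=u_0$ such that, for each $1\le n\le N$, $u^n$ solves step $n$ of (S) with earlier levels $u^0,\dots,u^{n-1}$. -/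

import Mathlib

open MeasureTheory Set
open scoped ContDiff

noncomputable section

namespace AllenCahnBDF3

/-! ### Time levels and the variable-step kernels -/

/-- Nonuniform time levels `0 = t₀ < t₁ < ⋯ < t_N = T`. -/
structure IsTimeGrid (T : ℝ) (N : ℕ) (t : ℕ → ℝ) : Prop where
  zero : t 0 = 0
  last : t N = T
  lt_succ : ∀ k, k < N → t k < t (k + 1)

/-- The time-step `τ_k = t_k - t_{k-1}`, for `k ≥ 1`. -/
def tau (t : ℕ → ℝ) (k : ℕ) : ℝ := t k - t (k - 1)

/-- The adjacent time-step ratio `r_k = τ_k / τ_{k-1}`, for `k ≥ 2`. -/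
def ratio (t : ℕ → ℝ) (k : ℕ) : ℝ := tau t k / tau t (k - 1)

/-- The common denominator of the three-step kernels at level `n ≥ 3`. -/
def kernelDenom (t : ℕ → ℝ) (n : ℕ) : ℝ :=
  tau t n * (1 + ratio t n) * (1 + ratio t (n - 1))
    * (1 + ratio t (n - 1) + ratio t n * ratio t (n - 1))

/-- `kernel t n j` is the kernel `b_j^{(n)}`, for `n ≥ 1`: one-step (BDF1) kernels at level `1`,
two-step (BDF2) kernels at level `2`, three-step (BDF3) kernels at all levels `n ≥ 3`. -/
def kernel (t : ℕ → ℝ) (n j : ℕ) : ℝ :=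
  if n = 1 then
    if j = 0 then 1 / tau t 1 else 0
  else if n = 2 then
    if j = 0 then (1 + 2 * ratio t 2) / (tau t 2 * (1 + ratio t 2))
    else if j = 1 then -(ratio t 2 ^ 2 / (tau t 2 * (1 + ratio t 2)))
    else 0
  else
    if j = 0 then
      (1 + ratio t (n - 1)) *
          (1 + 2 * ratio t n + ratio t (n - 1) * (1 + 4 * ratio t n + 3 * ratio t n ^ 2))
        / kernelDenom t n
    else if j = 1 then
      -(ratio t n ^ 2 *
          ((1 + 2 * ratio t (n - 1) + ratio t n * ratio t (n - 1)) ^ 2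
            - ratio t (n - 1) * (1 + ratio t (n - 1)))
        / kernelDenom t n)
    else if j = 2 then
      ratio t n ^ 2 * ratio t (n - 1) ^ 3 * (1 + ratio t n) ^ 2 / kernelDenom t n
    else 0

/-- The upper bound for the time-step `τ_n`: the bound in terms of `r_n` and `r_{n-1}` for `n ≥ 3`,
and its value with the absent ratios replaced by zero at the two starting levels. -/
def stepBound (t : ℕ → ℝ) (n : ℕ) : ℝ :=
  if n = 1 then 1
  else if n = 2 then (1 + 2 * ratio t 2) / (1 + ratio t 2)
  else
    (1 + 2 * ratio t n + ratio t (n - 1) * (1 + 4 * ratio t n + 3 * ratio t n ^ 2))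
      / ((1 + ratio t n) * (1 + ratio t (n - 1) + ratio t n * ratio t (n - 1)))

/-- The backward difference `v^k - v^{k-1}`, for `k ≥ 1`. -/
def nabla {E : Type*} [AddCommGroup E] (v : ℕ → E) (k : ℕ) : E := v k - v (k - 1)

/-- The discrete time derivative `D₃ v^n = ∑_{k=1}^n b_{n-k}^{(n)} (v^k - v^{k-1})`. -/
def D3 {E : Type*} [AddCommGroup E] [Module ℝ E] (t : ℕ → ℝ) (v : ℕ → E) (n : ℕ) : E :=
  ∑ k ∈ Finset.Icc 1 n, kernel t n (n - k) • nabla v k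

/-- The part `∑_{k=1}^{n-1} b_{n-k}^{(n)} (v^k - v^{k-1})` of `D₃ v^n` that only involves
the earlier levels; for `n ≥ 3` it is `b_1^{(n)} ∇v^{n-1} + b_2^{(n)} ∇v^{n-2}`. -/
def history {E : Type*} [AddCommGroup E] [Module ℝ E] (t : ℕ → ℝ) (v : ℕ → E) (n : ℕ) : E :=
  ∑ k ∈ Finset.Ico 1 n, kernel t n (n - k) • nabla v k

/-! ### Periodic function spaces on a box -/

variable {d : ℕ}

/-- The periodic cell `Ω = ∏ i, (0, L i)`. -/
def cell (L : Fin d → ℝ) : Set (Fin d → ℝ) := Set.univ.pi fun i => Ioo 0 (L i)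

/-- Lebesgue measure on the cell. -/
abbrev cellMeasure (L : Fin d → ℝ) : Measure (Fin d → ℝ) := volume.restrict (cell L)

/-- The real Hilbert space `L²(Ω)`. -/
abbrev L2 (L : Fin d → ℝ) : Type := Lp ℝ 2 (cellMeasure L)

/-- The classical partial derivative `∂_i φ`. -/
def partialDeriv (i : Fin d) (φ : (Fin d → ℝ) → ℝ) (x : Fin d → ℝ) : ℝ :=
  fderiv ℝ φ x (Pi.single i 1)

/-- Smooth functions on `ℝ^d` with period `L i` in the `i`-th coordinate direction. -/
structure IsPeriodicTest (L : Fin d → ℝ) (φ : (Fin d → ℝ) → ℝ) : Prop where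
  smooth : ContDiff ℝ ∞ φ
  periodic : ∀ (i : Fin d) (x : Fin d → ℝ), φ (x + Pi.single i (L i)) = φ x

/-- `g` is the weak `i`-th partial derivative of `u`, under periodic boundary conditions. -/
def HasWeakPartial (L : Fin d → ℝ) (i : Fin d) (u g : L2 L) : Prop :=
  ∀ φ : (Fin d → ℝ) → ℝ, IsPeriodicTest L φ →
    ∫ x in cell L, u x * partialDeriv i φ x = -∫ x in cell L, g x * φ x

open Classical in
/-- The weak `i`-th partial derivative of `u` (zero if there is none). -/
def weakPartial (L : Fin d → ℝ) (i : Fin d) (u : L2 L) : L2 L :=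
  if h : ∃ g, HasWeakPartial L i u g then h.choose else 0

/-- The energy space `H¹_per(Ω) ∩ L⁴(Ω)`, on which the free energy is finite. -/
def energySpace (L : Fin d → ℝ) : Set (L2 L) :=
  {u | (∀ i, ∃ g, HasWeakPartial L i u g) ∧ MemLp u 4 (cellMeasure L)}

/-- The `L²` inner product `(∇u, ∇w)` of the weak gradients. -/
def gradInner (L : Fin d → ℝ) (u w : L2 L) : ℝ :=
  ∑ i, inner ℝ (weakPartial L i u) (weakPartial L i w)

/-- `w ∈ L¹(Ω)` is the distributional Laplacian of `u`, under periodic boundary conditions. -/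
def HasWeakLaplacian (L : Fin d → ℝ) (u : L2 L) (w : (Fin d → ℝ) → ℝ) : Prop :=
  Integrable w (cellMeasure L) ∧
    ∀ φ : (Fin d → ℝ) → ℝ, IsPeriodicTest L φ →
      ∫ x in cell L, u x * ∑ i, partialDeriv i (partialDeriv i φ) x
        = ∫ x in cell L, w x * φ x

/-! ### The scheme -/

/-- The bulk force `f(s) = s³ - s`. -/
def bulkForce (s : ℝ) : ℝ := s ^ 3 - s

/-- The sequence `v` solves `D₃ v^n - ε² Δ v^n + f(v^n) = 0` at level `n`, in the usual weak sense
on the energy space: `(D₃ v^n, ψ) + ε² (∇v^n, ∇ψ) + (f(v^n), ψ) = 0` for every `ψ`. -/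
def SolvesAt (L : Fin d → ℝ) (ε : ℝ) (t : ℕ → ℝ) (v : ℕ → L2 L) (n : ℕ) : Prop :=
  v n ∈ energySpace L ∧
    ∀ ψ ∈ energySpace L,
      inner ℝ (D3 t v n) ψ + ε ^ 2 * gradInner L (v n) ψ
        + ∫ x in cell L, bulkForce (v n x) * ψ x = 0

/-- The equation `D₃ v^n - ε² Δ v^n + f(v^n) = 0` holds almost everywhere in the cell, where
`Δ v^n` is the distributional Laplacian, an integrable function. -/
def SolvesAEAt (L : Fin d → ℝ) (ε : ℝ) (t : ℕ → ℝ) (v : ℕ → L2 L) (n : ℕ) : Prop :=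
  ∃ w : (Fin d → ℝ) → ℝ, HasWeakLaplacian L (v n) w ∧
    ∀ᵐ x ∂(cellMeasure L), D3 t v n x - ε ^ 2 * w x + bulkForce (v n x) = 0

/-- The sequence `v` solves the scheme at all levels `1, …, N`, with initial value `u₀`. -/
def SolvesScheme (L : Fin d → ℝ) (ε : ℝ) (t : ℕ → ℝ) (N : ℕ) (u₀ : L2 L) (v : ℕ → L2 L) : Prop :=
  v 0 = u₀ ∧ ∀ n, 1 ≤ n → n ≤ N → SolvesAt L ε t v n

/-- The energy functional of the `n`-th step, determined by the earlier levels of `v`: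
`G[z] = b_0/2 ‖z - v^{n-1}‖² + (b_1 ∇v^{n-1} + b_2 ∇v^{n-2}, z - v^{n-1})
  + ε²/2 ‖∇z‖² + 1/4 ‖z² - 1‖²`. -/
def stepEnergy (L : Fin d → ℝ) (ε : ℝ) (t : ℕ → ℝ) (v : ℕ → L2 L) (n : ℕ) (z : L2 L) : ℝ :=
  kernel t n 0 / 2 * ‖z - v (n - 1)‖ ^ 2
    + inner ℝ (history t v n) (z - v (n - 1))
    + ε ^ 2 / 2 * gradInner L z z
    + 1 / 4 * ∫ x in cell L, ((z x) ^ 2 - 1) ^ 2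

end AllenCahnBDF3

end

noncomputable section

namespace AllenCahnBDF3

open Filter Topology

variable {d : ℕ} {L : Fin d → ℝ}

/-! ### The cell -/

/-! Each step is the Euler–Lagrange equation of its energy. The double well contributes the only
concave term, `-1/2 ‖ψ‖²` for an increment `ψ`. The discrete time derivative contributes `b_0/2
‖ψ‖²`, so `b_0 > 1` makes the energy strongly convex in `L²`. The condition on `τ_n` is exactly this
inequality, because `b_0` equals the bound divided by `τ_n` (`kernel_zero_eq`).

The central tool is the exact expansion `energy_add`: increment = weak form + `convexityForm` + a
nonnegative quartic remainder. It identifies weak solutions with strict minimizers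
(`weakForm_eq_zero_iff_isMin`) and gives quantitative convexity (`energy_convexComb_le`).

Existence (`exists_isMin_energy`) needs no weak compactness. Quantitative convexity makes a
minimizing sequence Cauchy in `L²` together with its weak gradients; weak derivatives are closed
under such limits, and Fatou handles the quartic term. Periodization turns bump functions into
periodic test functions, which makes weak derivatives unique. -/

lemma isOpen_cell : IsOpen (cell L) := isOpen_set_pi finite_univ fun _ _ => isOpen_Ioo

lemma cell_subset_Icc : cell L ⊆ Icc 0 L := fun _ hx =>
  ⟨fun i => (hx i (mem_univ i)).1.le, fun i => (hx i (mem_univ i)).2.le⟩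

/-- Passes to the closed box, on which the divergence theorem is stated. -/
lemma cell_ae_eq_Icc : cell L =ᵐ[volume] Icc 0 L := by
  have := Measure.univ_pi_Ioo_ae_eq_Icc (μ := fun _ : Fin d => (volume : Measure ℝ))
    (f := 0) (g := L)
  simpa [cell, volume_pi] using this

instance : IsFiniteMeasure (cellMeasure L) :=
  ⟨by
    rw [Measure.restrict_apply_univ]
    exact (measure_mono cell_subset_Icc).trans_lt isCompact_Icc.measure_lt_top⟩

lemma ae_mem_cell : ∀ᵐ x ∂(cellMeasure L), x ∈ cell L :=
  ae_restrict_mem isOpen_cell.measurableSet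

/-! ### Periodic test functions -/

lemma memLp_of_continuous {φ : (Fin d → ℝ) → ℝ} (hφ : Continuous φ) (p : ENNReal) :
    MemLp φ p (cellMeasure L) := by
  obtain ⟨C, hC⟩ := (isCompact_Icc (a := (0 : Fin d → ℝ)) (b := L)).exists_bound_of_continuousOn
    hφ.continuousOn
  refine MemLp.of_bound hφ.aestronglyMeasurable C ?_
  filter_upwards [ae_mem_cell] with x hx using hC x (cell_subset_Icc hx)

lemma IsPeriodicTest.partialDeriv {φ : (Fin d → ℝ) → ℝ} (hφ : IsPeriodicTest L φ) (i : Fin d) :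
    IsPeriodicTest L (partialDeriv i φ) where
  smooth := by
    unfold AllenCahnBDF3.partialDeriv
    exact (hφ.smooth.fderiv_right (m := ∞) le_rfl).clm_apply contDiff_const
  periodic j x := by
    unfold AllenCahnBDF3.partialDeriv
    have : (fun y => φ (y + Pi.single j (L j))) = φ := funext (hφ.periodic j)
    rw [← fderiv_comp_add_right, this]

lemma IsPeriodicTest.mul {φ ψ : (Fin d → ℝ) → ℝ} (hφ : IsPeriodicTest L φ)
    (hψ : IsPeriodicTest L ψ) : IsPeriodicTest L (φ * ψ) where
  smooth := hφ.smooth.mul hψ.smooth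
  periodic i x := by simp [hφ.periodic, hψ.periodic]

lemma partialDeriv_mul {φ ψ : (Fin d → ℝ) → ℝ} (hφ : IsPeriodicTest L φ)
    (hψ : IsPeriodicTest L ψ) (i : Fin d) (x : Fin d → ℝ) :
    partialDeriv i (φ * ψ) x = φ x * partialDeriv i ψ x + partialDeriv i φ x * ψ x := by
  unfold partialDeriv
  rw [fderiv_mul (hφ.smooth.differentiable (by simp) x) (hψ.smooth.differentiable (by simp) x)]
  simp [mul_comm]

/-- The integral of a partial derivative of a smooth periodic function over the cell vanishes. -/
lemma integral_partialDeriv_eq_zero (hL : ∀ i, 0 < L i) {φ : (Fin d → ℝ) → ℝ}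
    (hφ : IsPeriodicTest L φ) (i : Fin d) : ∫ x in cell L, partialDeriv i φ x = 0 := by
  obtain _ | n := d
  · exact i.elim0
  rw [setIntegral_congr_set cell_ae_eq_Icc]
  have hcont : Continuous (partialDeriv i φ) := (hφ.partialDeriv i).smooth.continuous
  have hsum : ∀ x, (∑ j, (if j = i then fderiv ℝ φ x else 0) (Pi.single j 1))
      = partialDeriv i φ x := by
    intro x
    rw [Finset.sum_eq_single i (fun j _ hj => by simp [hj]) (by simp)]
    simp [partialDeriv]
  -- Divergence theorem for the vector field whose only nonzero component is `φ`, in direction `i`.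
  have key := integral_divergence_of_hasFDerivAt_off_countable' (0 : Fin (n + 1) → ℝ) L
    (fun j => (hL j).le) (fun j x => if j = i then φ x else 0)
    (fun j x => if j = i then fderiv ℝ φ x else 0) ∅ countable_empty
    (fun j => by
      by_cases h : j = i
      · simpa [h] using hφ.smooth.continuous.continuousOn
      · simpa [h] using continuousOn_const)
    (fun x _ j => by
      by_cases h : j = i
      · simpa [h] using (hφ.smooth.differentiable (by simp) x).hasFDerivAt
      · simpa [h] using hasFDerivAt_const (0 : ℝ) x)
    (by simpa only [hsum] using hcont.continuousOn.integrableOn_compact isCompact_Icc)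
  simp only [hsum] at key
  rw [key]
  refine Finset.sum_eq_zero fun j _ => ?_
  by_cases h : j = i
  · subst h
    -- By periodicity the fluxes through the two opposite faces cancel.
    have : ∀ y, φ (j.insertNth (L j) y) = φ (j.insertNth ((0 : Fin (n + 1) → ℝ) j) y) := by
      intro y
      rw [← hφ.periodic j (j.insertNth ((0 : Fin (n + 1) → ℝ) j) y)]
      congr 1
      ext k
      refine Fin.succAboveCases j ?_ (fun k => ?_) k
      · simp
      · simp
    simp [this]
  · simp [h]

/-- Integration by parts for smooth periodic functions. -/
lemma integral_mul_partialDeriv (hL : ∀ i, 0 < L i) {φ ψ : (Fin d → ℝ) → ℝ}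
    (hφ : IsPeriodicTest L φ) (hψ : IsPeriodicTest L ψ) (i : Fin d) :
    ∫ x in cell L, φ x * partialDeriv i ψ x = -∫ x in cell L, partialDeriv i φ x * ψ x := by
  have h := integral_partialDeriv_eq_zero hL (hφ.mul hψ) i
  simp only [partialDeriv_mul hφ hψ] at h
  rw [integral_add] at h
  · linarith
  · exact (memLp_of_continuous (hφ.smooth.continuous.mul
      (hψ.partialDeriv i).smooth.continuous) 1).integrable le_rfl
  · exact (memLp_of_continuous ((hφ.partialDeriv i).smooth.continuous.mul
      hψ.smooth.continuous) 1).integrable le_rfl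

/-! ### Periodization of functions vanishing off the cell -/

/-- The lattice vector with integer coordinates `k`. -/
def latticeVec (L : Fin d → ℝ) (k : Fin d → ℤ) : Fin d → ℝ := fun i => k i * L i

/-- The periodization of a function. -/
def periodize (L : Fin d → ℝ) (g : (Fin d → ℝ) → ℝ) (x : Fin d → ℝ) : ℝ :=
  ∑ᶠ k : Fin d → ℤ, g (x - latticeVec L k)

/-- If `y` is within distance `1` of `x` and `y - k L` lies in the cell, each `k i` is confined to a
bounded interval. This makes the `finsum` in `periodize` a genuine, locally finite sum, hence smooth
when `g` is. -/
lemma locallyFinite_translates (hL : ∀ i, 0 < L i) {g : (Fin d → ℝ) → ℝ}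
    (hg : ∀ x, x ∉ cell L → g x = 0) :
    LocallyFinite fun k : Fin d → ℤ => Function.support fun x => g (x - latticeVec L k) := by
  intro x
  refine ⟨Metric.ball x 1, Metric.ball_mem_nhds x one_pos, ?_⟩
  refine (Set.Finite.pi' fun i => Set.finite_Icc ⌊(x i - 1) / L i - 1⌋ ⌈(x i + 1) / L i⌉).subset ?_
  rintro k ⟨y, hy, hyx⟩ i
  have hyc : y - latticeVec L k ∈ cell L := by
    by_contra h
    exact hy (hg _ h)
  have h1 := hyc i (mem_univ i)
  have h2 : |y i - x i| < 1 := by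
    have := (dist_le_pi_dist y x i).trans_lt hyx
    rwa [Real.dist_eq] at this
  rw [abs_lt] at h2
  simp only [Pi.sub_apply, latticeVec, mem_Ioo] at h1
  have hLi := hL i
  constructor
  · have : ((x i - 1) / L i - 1) ≤ k i := by
      rw [sub_le_iff_le_add, div_le_iff₀ hLi]
      nlinarith
    exact_mod_cast (Int.floor_le _).trans this
  · have : (k i : ℝ) ≤ (x i + 1) / L i := by
      rw [le_div_iff₀ hLi]
      nlinarith
    exact_mod_cast this.trans (Int.le_ceil _)

lemma isPeriodicTest_periodize (hL : ∀ i, 0 < L i) {g : (Fin d → ℝ) → ℝ}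
    (hg : ∀ x, x ∉ cell L → g x = 0) (hs : ContDiff ℝ ∞ g) :
    IsPeriodicTest L (periodize L g) where
  smooth := by
    rw [← contMDiff_iff_contDiff]
    exact contMDiff_finsum
      (fun k => (hs.comp (contDiff_id.sub contDiff_const)).contMDiff)
      (locallyFinite_translates hL hg)
  periodic i x := by
    unfold periodize
    rw [← finsum_comp_equiv (Equiv.addRight (Pi.single i (1 : ℤ)))]
    refine finsum_congr fun k => ?_
    congr 1
    ext j
    by_cases h : j = i
    · subst h
      simp [latticeVec]
      ring
    · simp [latticeVec, h]

/-- Distinct lattice translates of the open cell are disjoint, so only `k = 0` contributes. -/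
lemma periodize_eq (hL : ∀ i, 0 < L i) {g : (Fin d → ℝ) → ℝ}
    (hg : ∀ x, x ∉ cell L → g x = 0) {x : Fin d → ℝ} (hx : x ∈ cell L) :
    periodize L g x = g x := by
  unfold periodize
  rw [finsum_eq_single _ (0 : Fin d → ℤ)]
  · congr 1
    ext i
    simp [latticeVec]
  · intro k hk
    apply hg
    intro hmem
    apply hk
    ext i
    have h1 := hmem i (mem_univ i)
    have h2 := hx i (mem_univ i)
    simp only [Pi.sub_apply, latticeVec, mem_Ioo] at h1 h2
    have hLi := hL i
    have h3 : (k i : ℝ) < 1 := by nlinarith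
    have h4 : (-1 : ℝ) < k i := by nlinarith
    have h5 : k i < 1 := by exact_mod_cast h3
    have h6 : -1 < k i := by exact_mod_cast h4
    simp only [Pi.zero_apply]
    omega

/-- Smooth periodic functions separate the integrable functions on the cell. -/
lemma ae_eq_zero_of_integral_mul_test (hL : ∀ i, 0 < L i) {g : (Fin d → ℝ) → ℝ}
    (hg : Integrable g (cellMeasure L))
    (h : ∀ φ, IsPeriodicTest L φ → ∫ x in cell L, g x * φ x = 0) : g =ᵐ[cellMeasure L] 0 := by
  have hmeas : MeasurableSet (cell L) := isOpen_cell.measurableSet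
  -- The fundamental lemma of the calculus of variations tests with bumps `η` supported in the cell;
  -- each may be replaced by its periodization, which agrees with it there.
  have := isOpen_cell.ae_eq_zero_of_integral_contDiff_smul_eq_zero (f := g) (U := cell L)
    (μ := volume) (IntegrableOn.locallyIntegrableOn hg) (fun η hη _ hsupp => by
      have h0 : ∀ x, x ∉ cell L → η x = 0 := fun x hx =>
        image_eq_zero_of_notMem_tsupport fun hx' => hx (hsupp hx')
      rw [← setIntegral_eq_integral_of_forall_compl_eq_zero (s := cell L)
        (fun x hx => by simp [h0 x hx]), ← h _ (isPeriodicTest_periodize hL h0 hη)]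
      refine setIntegral_congr_fun hmeas fun x hx => ?_
      simp [periodize_eq hL h0 hx, mul_comm])
  exact (ae_restrict_iff' hmeas).2 this

/-! ### Weak partial derivatives -/

lemma inner_eq_integral (u w : L2 L) : inner ℝ u w = ∫ x in cell L, u x * w x := by
  rw [L2.inner_def]
  refine integral_congr_ae (Eventually.of_forall fun x => ?_)
  simp [mul_comm]

lemma inner_toLp {φ : (Fin d → ℝ) → ℝ} (hφ : MemLp φ 2 (cellMeasure L)) (u : L2 L) :
    inner ℝ u (hφ.toLp φ) = ∫ x in cell L, u x * φ x := by
  rw [inner_eq_integral]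
  refine integral_congr_ae ?_
  filter_upwards [hφ.coeFn_toLp] with x hx
  rw [hx]

/-- A smooth periodic function as an element of `L²(Ω)`. -/
def testLp {φ : (Fin d → ℝ) → ℝ} (hφ : IsPeriodicTest L φ) : L2 L :=
  (memLp_of_continuous hφ.smooth.continuous 2).toLp φ

lemma coeFn_testLp {φ : (Fin d → ℝ) → ℝ} (hφ : IsPeriodicTest L φ) :
    testLp hφ =ᵐ[cellMeasure L] φ := MemLp.coeFn_toLp _

lemma inner_testLp {φ : (Fin d → ℝ) → ℝ} (hφ : IsPeriodicTest L φ) (u : L2 L) :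
    inner ℝ u (testLp hφ) = ∫ x in cell L, u x * φ x := inner_toLp _ u

lemma hasWeakPartial_iff {i : Fin d} {u g : L2 L} :
    HasWeakPartial L i u g ↔ ∀ φ (hφ : IsPeriodicTest L φ),
      inner ℝ u (testLp (hφ.partialDeriv i)) = -inner ℝ g (testLp hφ) := by
  simp only [inner_testLp]
  rfl

lemma HasWeakPartial.add {i : Fin d} {u g v h : L2 L} (hu : HasWeakPartial L i u g)
    (hv : HasWeakPartial L i v h) : HasWeakPartial L i (u + v) (g + h) := by
  rw [hasWeakPartial_iff] at *
  intro φ hφ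
  rw [inner_add_left, inner_add_left, hu φ hφ, hv φ hφ]
  ring

lemma HasWeakPartial.smul {i : Fin d} {u g : L2 L} (hu : HasWeakPartial L i u g) (c : ℝ) :
    HasWeakPartial L i (c • u) (c • g) := by
  rw [hasWeakPartial_iff] at *
  intro φ hφ
  rw [real_inner_smul_left, real_inner_smul_left, hu φ hφ]
  ring

/-- The weak derivative is a closed operator: its defining identity is a family of `L²`-continuous
equations. -/
lemma HasWeakPartial.of_tendsto {i : Fin d} {u g : L2 L} {U G : ℕ → L2 L}
    (h : ∀ n, HasWeakPartial L i (U n) (G n)) (hU : Tendsto U atTop (𝓝 u))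
    (hG : Tendsto G atTop (𝓝 g)) : HasWeakPartial L i u g := by
  simp only [hasWeakPartial_iff] at *
  intro φ hφ
  refine tendsto_nhds_unique (hU.inner tendsto_const_nhds) ?_
  simp only [h _ φ hφ]
  exact (hG.inner tendsto_const_nhds).neg

/-- Makes the choice inside `weakPartial` immaterial, so that `weakPartial` is linear on the energy
space. -/
lemma HasWeakPartial.unique (hL : ∀ i, 0 < L i) {i : Fin d} {u g h : L2 L}
    (hg : HasWeakPartial L i u g) (hh : HasWeakPartial L i u h) : g = h := by
  rw [hasWeakPartial_iff] at *
  have : (⇑(g - h) : (Fin d → ℝ) → ℝ) =ᵐ[cellMeasure L] 0 :=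
    ae_eq_zero_of_integral_mul_test hL ((Lp.memLp (g - h)).integrable (by norm_num))
      fun φ hφ => by
        rw [← inner_testLp hφ, inner_sub_left]
        linarith [hg φ hφ, hh φ hφ]
  rw [← sub_eq_zero]
  exact (Lp.eq_zero_iff_ae_eq_zero).2 this

lemma HasWeakPartial.weakPartial_eq (hL : ∀ i, 0 < L i) {i : Fin d} {u g : L2 L}
    (hg : HasWeakPartial L i u g) : weakPartial L i u = g := by
  have h : ∃ g, HasWeakPartial L i u g := ⟨g, hg⟩
  rw [weakPartial, dif_pos h]
  exact h.choose_spec.unique hL hg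

lemma hasWeakPartial_weakPartial {u : L2 L} (hu : u ∈ energySpace L) (i : Fin d) :
    HasWeakPartial L i u (weakPartial L i u) := by
  have h := hu.1 i
  rw [weakPartial, dif_pos h]
  exact h.choose_spec

lemma hasWeakPartial_testLp (hL : ∀ i, 0 < L i) {φ : (Fin d → ℝ) → ℝ} (hφ : IsPeriodicTest L φ)
    (i : Fin d) : HasWeakPartial L i (testLp hφ) (testLp (hφ.partialDeriv i)) := by
  intro ψ hψ
  have h1 : ∫ x in cell L, testLp hφ x * partialDeriv i ψ x
      = ∫ x in cell L, φ x * partialDeriv i ψ x :=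
    integral_congr_ae (by filter_upwards [coeFn_testLp hφ] with x hx; rw [hx])
  have h2 : ∫ x in cell L, testLp (hφ.partialDeriv i) x * ψ x
      = ∫ x in cell L, partialDeriv i φ x * ψ x :=
    integral_congr_ae (by filter_upwards [coeFn_testLp (hφ.partialDeriv i)] with x hx; rw [hx])
  rw [h1, h2, integral_mul_partialDeriv hL hφ hψ]

/-! ### The energy space -/

lemma zero_mem_energySpace : (0 : L2 L) ∈ energySpace L := by
  refine ⟨fun i => ⟨0, fun φ _ => ?_⟩, ?_⟩
  · have h : ∀ ψ : (Fin d → ℝ) → ℝ, ∫ x in cell L, (0 : L2 L) x * ψ x = 0 := fun ψ =>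
      integral_eq_zero_of_ae (by
        filter_upwards [Lp.coeFn_zero ℝ 2 (cellMeasure L)] with x hx
        rw [hx]
        simp)
    rw [h, h, neg_zero]
  · exact (memLp_congr_ae (Lp.coeFn_zero ℝ 2 (cellMeasure L))).2 MemLp.zero

lemma add_mem_energySpace {u v : L2 L} (hu : u ∈ energySpace L) (hv : v ∈ energySpace L) :
    u + v ∈ energySpace L :=
  ⟨fun i => ⟨_, (hu.1 i).choose_spec.add (hv.1 i).choose_spec⟩,
    (memLp_congr_ae (Lp.coeFn_add u v)).2 (hu.2.add hv.2)⟩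

lemma smul_mem_energySpace {u : L2 L} (hu : u ∈ energySpace L) (c : ℝ) :
    c • u ∈ energySpace L :=
  ⟨fun i => ⟨_, (hu.1 i).choose_spec.smul c⟩,
    (memLp_congr_ae (Lp.coeFn_smul c u)).2 (hu.2.const_smul c)⟩

lemma sub_mem_energySpace {u v : L2 L} (hu : u ∈ energySpace L) (hv : v ∈ energySpace L) :
    u - v ∈ energySpace L := by
  simpa [sub_eq_add_neg] using add_mem_energySpace hu (smul_mem_energySpace hv (-1))

lemma testLp_mem_energySpace (hL : ∀ i, 0 < L i) {φ : (Fin d → ℝ) → ℝ}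
    (hφ : IsPeriodicTest L φ) : testLp hφ ∈ energySpace L :=
  ⟨fun i => ⟨_, hasWeakPartial_testLp hL hφ i⟩,
    (memLp_congr_ae (coeFn_testLp hφ)).2 (memLp_of_continuous hφ.smooth.continuous 4)⟩

lemma weakPartial_add (hL : ∀ i, 0 < L i) {u v : L2 L} (hu : u ∈ energySpace L)
    (hv : v ∈ energySpace L) (i : Fin d) :
    weakPartial L i (u + v) = weakPartial L i u + weakPartial L i v :=
  ((hasWeakPartial_weakPartial hu i).add (hasWeakPartial_weakPartial hv i)).weakPartial_eq hL

lemma weakPartial_smul (hL : ∀ i, 0 < L i) {u : L2 L} (hu : u ∈ energySpace L) (c : ℝ)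
    (i : Fin d) : weakPartial L i (c • u) = c • weakPartial L i u :=
  ((hasWeakPartial_weakPartial hu i).smul c).weakPartial_eq hL

lemma weakPartial_sub (hL : ∀ i, 0 < L i) {u v : L2 L} (hu : u ∈ energySpace L)
    (hv : v ∈ energySpace L) (i : Fin d) :
    weakPartial L i (u - v) = weakPartial L i u - weakPartial L i v := by
  have := weakPartial_add hL hu (smul_mem_energySpace hv (-1)) i
  rw [weakPartial_smul hL hv] at this
  simpa [sub_eq_add_neg] using this

lemma convex_energySpace : Convex ℝ (energySpace L) := fun _ hu _ hv _ _ _ _ _ =>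
  add_mem_energySpace (smul_mem_energySpace hu _) (smul_mem_energySpace hv _)

lemma gradInner_comm (u v : L2 L) : gradInner L u v = gradInner L v u :=
  Finset.sum_congr rfl fun _ _ => real_inner_comm _ _

lemma gradInner_self_nonneg (u : L2 L) : 0 ≤ gradInner L u u :=
  Finset.sum_nonneg fun _ _ => real_inner_self_nonneg

lemma gradInner_add_right (hL : ∀ i, 0 < L i) (u : L2 L) {v w : L2 L} (hv : v ∈ energySpace L)
    (hw : w ∈ energySpace L) : gradInner L u (v + w) = gradInner L u v + gradInner L u w := by
  simp only [gradInner, weakPartial_add hL hv hw, inner_add_right, Finset.sum_add_distrib]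

lemma gradInner_smul_right (hL : ∀ i, 0 < L i) (u : L2 L) {v : L2 L} (hv : v ∈ energySpace L)
    (c : ℝ) : gradInner L u (c • v) = c * gradInner L u v := by
  simp only [gradInner, weakPartial_smul hL hv, real_inner_smul_right, Finset.mul_sum]

lemma gradInner_add_self (hL : ∀ i, 0 < L i) {u v : L2 L} (hu : u ∈ energySpace L)
    (hv : v ∈ energySpace L) :
    gradInner L (u + v) (u + v) = gradInner L u u + 2 * gradInner L u v + gradInner L v v := by
  rw [gradInner_add_right hL _ hu hv, gradInner_comm (u + v) u, gradInner_comm (u + v) v,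
    gradInner_add_right hL _ hu hv, gradInner_add_right hL _ hu hv, gradInner_comm v u]
  ring

/-! ### Integrability of quartic expressions -/

lemma integrable_pow_four {u : (Fin d → ℝ) → ℝ} (hu : MemLp u 4 (cellMeasure L)) :
    Integrable (fun x => u x ^ 4) (cellMeasure L) := by
  have := hu.integrable_norm_pow (p := 4) (by norm_num)
  refine this.congr (Eventually.of_forall fun x => ?_)
  simp [Even.pow_abs (⟨2, rfl⟩ : Even 4)]

lemma memLp_four_of_integrable {u : (Fin d → ℝ) → ℝ}
    (hm : AEStronglyMeasurable u (cellMeasure L))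
    (hu : Integrable (fun x => u x ^ 4) (cellMeasure L)) : MemLp u 4 (cellMeasure L) := by
  rw [← integrable_norm_rpow_iff hm (by norm_num) (by norm_num)]
  refine hu.congr (Eventually.of_forall fun x => ?_)
  have h4 : (4 : ENNReal).toReal = ((4 : ℕ) : ℝ) := by norm_num
  simp only [h4, Real.rpow_natCast, Real.norm_eq_abs]
  exact (Even.pow_abs (⟨2, rfl⟩ : Even 4) _).symm

/-- The cell has finite measure, so `L⁴` membership makes the dominating function integrable. All
integrands of the energy expansion are treated this way. -/
lemma integrable_of_quartic_bound {u v : (Fin d → ℝ) → ℝ} (hu : MemLp u 4 (cellMeasure L))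
    (hv : MemLp v 4 (cellMeasure L)) {F : ℝ → ℝ → ℝ} (hF : Continuous (Function.uncurry F))
    (C : ℝ) (hb : ∀ a b, |F a b| ≤ C * (1 + a ^ 4 + b ^ 4)) :
    Integrable (fun x => F (u x) (v x)) (cellMeasure L) := by
  refine Integrable.mono' (g := fun x => C * (1 + u x ^ 4 + v x ^ 4)) ?_ ?_ ?_
  · exact (((integrable_const 1).add (integrable_pow_four hu)).add
      (integrable_pow_four hv)).const_mul C
  · exact hF.comp_aestronglyMeasurable (hu.1.prodMk hv.1)
  · exact Eventually.of_forall fun x => hb _ _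

lemma integrable_doubleWell {u : (Fin d → ℝ) → ℝ} (hu : MemLp u 4 (cellMeasure L)) :
    Integrable (fun x => (u x ^ 2 - 1) ^ 2) (cellMeasure L) :=
  integrable_of_quartic_bound hu hu (F := fun a _ => (a ^ 2 - 1) ^ 2) (by fun_prop) 2
    fun a b => by
      rw [abs_le]
      constructor <;> nlinarith [sq_nonneg (a ^ 2 - 1), sq_nonneg (a ^ 2 + 1), sq_nonneg (b ^ 2)]

lemma integrable_bulkForce_mul {u v : (Fin d → ℝ) → ℝ} (hu : MemLp u 4 (cellMeasure L))
    (hv : MemLp v 4 (cellMeasure L)) :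
    Integrable (fun x => bulkForce (u x) * v x) (cellMeasure L) :=
  integrable_of_quartic_bound hu hv (F := fun a b => bulkForce a * b)
    (by unfold bulkForce; fun_prop) 4
    fun a b => by
      unfold bulkForce
      rw [abs_le]
      constructor <;>
      nlinarith [sq_nonneg (a ^ 2 - a * b), sq_nonneg (a ^ 2 + a * b), sq_nonneg (a ^ 2 - b ^ 2),
        sq_nonneg (a ^ 2 - 1), sq_nonneg (b ^ 2 - 1), sq_nonneg (a - b), sq_nonneg (a + b)]

/-- The integrand of the remainder in the second order expansion of the quartic energy. -/
def quarticRemainder (a b : ℝ) : ℝ := b ^ 2 * (2 * a ^ 2 + (2 * a + b) ^ 2)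

lemma quarticRemainder_nonneg (a b : ℝ) : 0 ≤ quarticRemainder a b := by
  unfold quarticRemainder
  positivity

lemma integrable_quarticRemainder {u v : (Fin d → ℝ) → ℝ} (hu : MemLp u 4 (cellMeasure L))
    (hv : MemLp v 4 (cellMeasure L)) :
    Integrable (fun x => quarticRemainder (u x) (v x)) (cellMeasure L) :=
  integrable_of_quartic_bound hu hv (by unfold quarticRemainder; fun_prop) 20
    fun a b => by
      rw [abs_of_nonneg (quarticRemainder_nonneg a b)]
      unfold quarticRemainder
      nlinarith [sq_nonneg (2 * a - b), mul_nonneg (sq_nonneg b) (sq_nonneg (2 * a - b)),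
        sq_nonneg (a ^ 2 - b ^ 2), sq_nonneg (a ^ 2), sq_nonneg (b ^ 2)]

/-! ### The energy of a single step -/

/-- The double-well potential `∫ (z² - 1)²`. -/
def doubleWell (L : Fin d → ℝ) (z : L2 L) : ℝ := ∫ x in cell L, ((z x) ^ 2 - 1) ^ 2

lemma doubleWell_nonneg (z : L2 L) : 0 ≤ doubleWell L z :=
  integral_nonneg fun _ => sq_nonneg _

/-- The step energy with leading kernel `b`, history term `h` and previous level `w`. -/
def energy (L : Fin d → ℝ) (ε b : ℝ) (h w z : L2 L) : ℝ :=
  b / 2 * ‖z - w‖ ^ 2 + inner ℝ h (z - w) + ε ^ 2 / 2 * gradInner L z z + 1 / 4 * doubleWell L z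

/-- The weak form of the step equation with leading kernel `b`, history term `h` and previous
level `w`. -/
def weakForm (L : Fin d → ℝ) (ε b : ℝ) (h w u ψ : L2 L) : ℝ :=
  inner ℝ (b • (u - w) + h) ψ + ε ^ 2 * gradInner L u ψ
    + ∫ x in cell L, bulkForce (u x) * ψ x

/-- The quadratic form that measures the convexity of the step energy. -/
def convexityForm (L : Fin d → ℝ) (ε b : ℝ) (ψ : L2 L) : ℝ :=
  (b - 1) / 2 * ‖ψ‖ ^ 2 + ε ^ 2 / 2 * gradInner L ψ ψ

section Energy

variable {ε b : ℝ} {h w u ψ : L2 L}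

lemma weakForm_smul (hL : ∀ i, 0 < L i) (hψ : ψ ∈ energySpace L) (c : ℝ) :
    weakForm L ε b h w u (c • ψ) = c * weakForm L ε b h w u ψ := by
  have : ∫ x in cell L, bulkForce (u x) * (c • ψ) x
      = c * ∫ x in cell L, bulkForce (u x) * ψ x := by
    rw [← integral_const_mul]
    refine integral_congr_ae ?_
    filter_upwards [Lp.coeFn_smul c ψ] with x hx
    rw [hx]
    simp only [Pi.smul_apply, smul_eq_mul]
    ring
  rw [weakForm, weakForm, this, real_inner_smul_right, gradInner_smul_right hL _ hψ]
  ring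

lemma convexityForm_smul (hL : ∀ i, 0 < L i) (hψ : ψ ∈ energySpace L) (c : ℝ) :
    convexityForm L ε b (c • ψ) = c ^ 2 * convexityForm L ε b ψ := by
  rw [convexityForm, convexityForm, gradInner_smul_right hL _ hψ, gradInner_comm,
    gradInner_smul_right hL _ hψ, norm_smul, mul_pow, Real.norm_eq_abs, sq_abs]
  ring

lemma convexityForm_pos (hb : 1 < b) (hψ : ψ ≠ 0) : 0 < convexityForm L ε b ψ := by
  have h1 : 0 < ‖ψ‖ := norm_pos_iff.2 hψ
  have h2 := gradInner_self_nonneg ψ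
  have h3 : 0 < b - 1 := by linarith
  unfold convexityForm
  positivity

/-- Pointwise Taylor expansion of `(s² - 1)²`. The second and higher order terms split into `-2 ψ²`,
the sole source of nonconvexity, and a nonnegative remainder. -/
lemma doubleWell_add (hu : MemLp u 4 (cellMeasure L)) (hψ : MemLp ψ 4 (cellMeasure L)) :
    doubleWell L (u + ψ) = doubleWell L u + 4 * (∫ x in cell L, bulkForce (u x) * ψ x)
      - 2 * ‖ψ‖ ^ 2 + ∫ x in cell L, quarticRemainder (u x) (ψ x) := by
  have hn : ‖ψ‖ ^ 2 = ∫ x in cell L, ψ x * ψ x := by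
    rw [← inner_eq_integral, real_inner_self_eq_norm_sq]
  have hsq : Integrable (fun x => ψ x * ψ x) (cellMeasure L) :=
    (Lp.memLp ψ).integrable_mul (Lp.memLp ψ)
  have h1 := integrable_doubleWell hu
  have h2 := (integrable_bulkForce_mul hu hψ).const_mul 4
  have h3 := hsq.const_mul 2
  have h4 := integrable_quarticRemainder hu hψ
  have h12 : Integrable (fun x => (u x ^ 2 - 1) ^ 2 + 4 * (bulkForce (u x) * ψ x))
      (cellMeasure L) := h1.add h2
  have h123 : Integrable (fun x => (u x ^ 2 - 1) ^ 2 + 4 * (bulkForce (u x) * ψ x)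
      - 2 * (ψ x * ψ x)) (cellMeasure L) := h12.sub h3
  rw [hn, doubleWell, doubleWell, ← integral_const_mul, ← integral_const_mul,
    ← integral_add h1 h2, ← integral_sub h12 h3, ← integral_add h123 h4]
  refine integral_congr_ae ?_
  filter_upwards [Lp.coeFn_add u ψ] with x hx
  simp only [hx, Pi.add_apply, bulkForce, quarticRemainder]
  ring

/-- Second order expansion of the step energy. -/
lemma energy_add (hL : ∀ i, 0 < L i) (hu : u ∈ energySpace L) (hψ : ψ ∈ energySpace L) :
    energy L ε b h w (u + ψ) = energy L ε b h w u + weakForm L ε b h w u ψ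
      + convexityForm L ε b ψ + 1 / 4 * ∫ x in cell L, quarticRemainder (u x) (ψ x) := by
  have hn : ‖u + ψ - w‖ ^ 2 = ‖u - w‖ ^ 2 + 2 * inner ℝ (u - w) ψ + ‖ψ‖ ^ 2 := by
    rw [show u + ψ - w = (u - w) + ψ by abel, norm_add_sq_real]
  have hi : inner ℝ h (u + ψ - w) = inner ℝ h (u - w) + inner ℝ h ψ := by
    rw [show u + ψ - w = (u - w) + ψ by abel, inner_add_right]
  rw [energy, energy, weakForm, convexityForm, hn, hi, gradInner_add_self hL hu hψ,
    doubleWell_add hu.2 hψ.2, inner_add_left, real_inner_smul_left]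
  ring

lemma energy_add_smul_ge (hL : ∀ i, 0 < L i) (hu : u ∈ energySpace L) (hψ : ψ ∈ energySpace L)
    (c : ℝ) : energy L ε b h w u + c * weakForm L ε b h w u ψ + c ^ 2 * convexityForm L ε b ψ
      ≤ energy L ε b h w (u + c • ψ) := by
  rw [energy_add hL hu (smul_mem_energySpace hψ c), weakForm_smul hL hψ,
    convexityForm_smul hL hψ]
  have : 0 ≤ ∫ x in cell L, quarticRemainder (u x) ((c • ψ) x) :=
    integral_nonneg fun _ => quarticRemainder_nonneg _ _
  linarith

/-- Near a point the step energy exceeds its linear approximation at most quadratically. -/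
lemma exists_energy_add_smul_le (hL : ∀ i, 0 < L i) (hu : u ∈ energySpace L)
    (hψ : ψ ∈ energySpace L) : ∃ M, 0 ≤ M ∧ ∀ c : ℝ, |c| ≤ 1 → energy L ε b h w (u + c • ψ)
      ≤ energy L ε b h w u + c * weakForm L ε b h w u ψ + c ^ 2 * M := by
  have hK : Integrable (fun x => 10 * (ψ x ^ 2 * (u x ^ 2 + ψ x ^ 2))) (cellMeasure L) :=
    integrable_of_quartic_bound hu.2 hψ.2 (F := fun a b => 10 * (b ^ 2 * (a ^ 2 + b ^ 2)))
      (by fun_prop) 20 fun a b => by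
        rw [abs_of_nonneg (by positivity)]
        nlinarith [sq_nonneg (a ^ 2 - b ^ 2), sq_nonneg (a ^ 2), sq_nonneg (b ^ 2)]
  set K := ∫ x in cell L, 10 * (ψ x ^ 2 * (u x ^ 2 + ψ x ^ 2)) with hKdef
  have hK0 : 0 ≤ K := integral_nonneg fun x => by positivity
  refine ⟨|convexityForm L ε b ψ| + K / 4, by positivity, fun c hc => ?_⟩
  rw [energy_add hL hu (smul_mem_energySpace hψ c), weakForm_smul hL hψ,
    convexityForm_smul hL hψ]
  -- One factor `c ^ 2` is explicit in the remainder; the other occurrences of `c` are absorbed by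
  -- `|c| ≤ 1`.
  have hR : ∫ x in cell L, quarticRemainder (u x) ((c • ψ) x) ≤ c ^ 2 * K := by
    rw [hKdef, ← integral_const_mul]
    refine integral_mono_ae (integrable_quarticRemainder hu.2 (smul_mem_energySpace hψ c).2)
      (hK.const_mul _) ?_
    filter_upwards [Lp.coeFn_smul c ψ] with x hx
    simp only [hx, Pi.smul_apply, smul_eq_mul, quarticRemainder]
    have h1 : c ^ 2 ≤ 1 := by rwa [sq_le_one_iff_abs_le_one]
    have h2 : (2 * u x + c * ψ x) ^ 2 ≤ 8 * u x ^ 2 + 2 * ψ x ^ 2 := by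
      nlinarith [sq_nonneg (2 * u x - c * ψ x), mul_le_mul_of_nonneg_right h1 (sq_nonneg (ψ x))]
    have h3 : 2 * u x ^ 2 + (2 * u x + c * ψ x) ^ 2 ≤ 10 * (u x ^ 2 + ψ x ^ 2) := by
      nlinarith [sq_nonneg (ψ x)]
    calc (c * ψ x) ^ 2 * (2 * u x ^ 2 + (2 * u x + c * ψ x) ^ 2)
        ≤ (c * ψ x) ^ 2 * (10 * (u x ^ 2 + ψ x ^ 2)) :=
          mul_le_mul_of_nonneg_left h3 (sq_nonneg _)
      _ = c ^ 2 * (10 * (ψ x ^ 2 * (u x ^ 2 + ψ x ^ 2))) := by ring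
  nlinarith [mul_le_mul_of_nonneg_left (le_abs_self (convexityForm L ε b ψ)) (sq_nonneg c)]

lemma eq_zero_of_forall_linear_add_sq_nonneg {A M : ℝ} (hM : 0 ≤ M)
    (h : ∀ c : ℝ, |c| ≤ 1 → 0 ≤ c * A + c ^ 2 * M) : A = 0 := by
  by_contra hA
  have hA' : 0 < |A| := abs_pos.2 hA
  have hD : 0 < |A| + M + 1 := by positivity
  -- A small step against the sign of `A`: the denominator exceeds `|A|`, so the step is admissible,
  -- and exceeds `M`, so the linear term wins.
  have h1 := h (-A / (|A| + M + 1)) (by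
    rw [abs_div, abs_neg, abs_of_pos hD, div_le_one hD]
    linarith)
  have h2 : -A / (|A| + M + 1) * A + (-A / (|A| + M + 1)) ^ 2 * M
      = -(A ^ 2 * (|A| + 1)) / (|A| + M + 1) ^ 2 := by
    field_simp
    ring
  have h3 : 0 < A ^ 2 * (|A| + 1) / (|A| + M + 1) ^ 2 := by
    have := sq_pos_of_ne_zero hA
    positivity
  rw [h2, neg_div] at h1
  linarith

/-- Critical points of the step energy are its strict minimizers. -/
lemma weakForm_eq_zero_iff_isMin (hL : ∀ i, 0 < L i) (hb : 1 < b) (hu : u ∈ energySpace L) :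
    (∀ ψ ∈ energySpace L, weakForm L ε b h w u ψ = 0) ↔
      ∀ z ∈ energySpace L, z ≠ u → energy L ε b h w u < energy L ε b h w z := by
  constructor
  · intro H z hz hzu
    have hψ := sub_mem_energySpace hz hu
    have h1 := energy_add_smul_ge (ε := ε) (b := b) (h := h) (w := w) hL hu hψ 1
    have h2 : 0 < convexityForm L ε b (z - u) := convexityForm_pos hb (sub_ne_zero.2 hzu)
    rw [one_smul, add_sub_cancel, H _ hψ] at h1
    linarith
  · intro H ψ hψ
    obtain ⟨M, hM, hle⟩ := exists_energy_add_smul_le (ε := ε) (b := b) (h := h) (w := w) hL hu hψ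
    refine eq_zero_of_forall_linear_add_sq_nonneg hM fun c hc => ?_
    have h1 := hle c hc
    have h2 : energy L ε b h w u ≤ energy L ε b h w (u + c • ψ) := by
      by_cases hz : u + c • ψ = u
      · rw [hz]
      · exact (H _ (add_mem_energySpace hu (smul_mem_energySpace hψ c)) hz).le
    linarith

/-- Quantitative convexity of the step energy. -/
lemma energy_convexComb_le (hL : ∀ i, 0 < L i) {x y : L2 L} (hx : x ∈ energySpace L)
    (hy : y ∈ energySpace L) {s r : ℝ} (hs : 0 ≤ s) (hr : 0 ≤ r) (hsr : s + r = 1) :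
    energy L ε b h w (s • x + r • y) + s * r * convexityForm L ε b (x - y)
      ≤ s * energy L ε b h w x + r * energy L ε b h w y := by
  have hm : s • x + r • y ∈ energySpace L := convex_energySpace hx hy hs hr hsr
  have hψ := sub_mem_energySpace hx hy
  have hs' : s = 1 - r := by linarith
  have ex : s • x + r • y + r • (x - y) = x := by
    rw [hs']
    module
  have ey : s • x + r • y + (-s) • (x - y) = y := by
    rw [hs']
    module
  -- Expand at the convex combination towards both endpoints. With weights `s` and `r` the linear
  -- terms cancel, and `s r² + r s² = s r`.
  have h1 := energy_add_smul_ge (ε := ε) (b := b) (h := h) (w := w) hL hm hψ r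
  have h2 := energy_add_smul_ge (ε := ε) (b := b) (h := h) (w := w) hL hm hψ (-s)
  rw [ex] at h1
  rw [ey] at h2
  have h3 := mul_le_mul_of_nonneg_left h1 hs
  have h4 := mul_le_mul_of_nonneg_left h2 hr
  have e : s * (energy L ε b h w (s • x + r • y) +
        r * weakForm L ε b h w (s • x + r • y) (x - y) + r ^ 2 * convexityForm L ε b (x - y))
      + r * (energy L ε b h w (s • x + r • y) +
        -s * weakForm L ε b h w (s • x + r • y) (x - y)
          + (-s) ^ 2 * convexityForm L ε b (x - y))
      = energy L ε b h w (s • x + r • y) + s * r * convexityForm L ε b (x - y) := by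
    rw [hs']
    ring
  linarith

lemma strictConvexOn_energy (hL : ∀ i, 0 < L i) (hb : 1 < b) :
    StrictConvexOn ℝ (energySpace L) (energy L ε b h w) := by
  refine ⟨convex_energySpace, fun x hx y hy hxy s r hs hr hsr => ?_⟩
  have h1 := energy_convexComb_le (ε := ε) (b := b) (h := h) (w := w) hL hx hy hs.le hr.le hsr
  have h2 := mul_pos (mul_pos hs hr) (convexityForm_pos (ε := ε) hb (sub_ne_zero.2 hxy))
  simp only [smul_eq_mul]
  linarith

/-! ### Existence of a minimizer -/

/-- Converts the energy gaps `1 / (n + 1)` of a minimizing sequence into strong convergence. -/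
lemma cauchySeq_of_sq_le {E : Type*} [NormedAddCommGroup E] {x : ℕ → E} {c : ℝ} (hc : 0 < c)
    (h : ∀ n k, c * ‖x n - x k‖ ^ 2 ≤ 1 / (n + 1 : ℝ) + 1 / (k + 1 : ℝ)) : CauchySeq x := by
  rw [Metric.cauchySeq_iff']
  intro δ hδ
  obtain ⟨N, hN⟩ := exists_nat_one_div_lt (show 0 < c * δ ^ 2 / 2 by positivity)
  refine ⟨N, fun n hn => ?_⟩
  have h1 : 1 / (n + 1 : ℝ) ≤ 1 / (N + 1 : ℝ) := Nat.one_div_le_one_div hn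
  have h2 : c * ‖x n - x N‖ ^ 2 < c * δ ^ 2 := by linarith [h n N]
  rw [dist_eq_norm]
  exact lt_of_pow_lt_pow_left₀ 2 hδ.le (lt_of_mul_lt_mul_left h2 hc.le)

/-- Lower semicontinuity of the double-well potential in `L²(Ω)`. -/
lemma doubleWell_le_of_tendsto {z : ℕ → L2 L} (hz : ∀ n, MemLp (z n) 4 (cellMeasure L))
    (hzu : Tendsto z atTop (𝓝 u)) {ℓ : ℝ}
    (hℓ : Tendsto (fun n => doubleWell L (z n)) atTop (𝓝 ℓ)) :
    MemLp u 4 (cellMeasure L) ∧ doubleWell L u ≤ ℓ := by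
  obtain ⟨ns, hns, hae⟩ := (tendstoInMeasure_of_tendsto_Lp hzu).exists_seq_tendsto_ae
  have hum : AEStronglyMeasurable (u : (Fin d → ℝ) → ℝ) (cellMeasure L) :=
    Lp.aestronglyMeasurable u
  have hcont : Continuous fun s : ℝ => (s ^ 2 - 1) ^ 2 := by fun_prop
  have hℓ0 : 0 ≤ ℓ := ge_of_tendsto' hℓ fun n => doubleWell_nonneg _
  have hWm : AEStronglyMeasurable (fun x => (u x ^ 2 - 1) ^ 2) (cellMeasure L) :=
    hcont.comp_aestronglyMeasurable hum
  -- Fatou along an almost everywhere convergent subsequence.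
  have hfat : ∫⁻ x, ENNReal.ofReal ((u x ^ 2 - 1) ^ 2) ∂(cellMeasure L) ≤ ENNReal.ofReal ℓ := by
    calc ∫⁻ x, ENNReal.ofReal ((u x ^ 2 - 1) ^ 2) ∂(cellMeasure L)
        = ∫⁻ x, liminf (fun k => ENNReal.ofReal ((z (ns k) x ^ 2 - 1) ^ 2)) atTop
            ∂(cellMeasure L) := by
          refine lintegral_congr_ae ?_
          filter_upwards [hae] with x hx
          exact (((ENNReal.continuous_ofReal.comp hcont).tendsto _).comp hx).liminf_eq.symm
      _ ≤ liminf (fun k => ∫⁻ x, ENNReal.ofReal ((z (ns k) x ^ 2 - 1) ^ 2) ∂(cellMeasure L))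
            atTop := lintegral_liminf_le' fun k =>
          (hcont.comp_aestronglyMeasurable
            (Lp.aestronglyMeasurable (z (ns k)))).aemeasurable.ennreal_ofReal
      _ = ENNReal.ofReal ℓ := by
          have : (fun k => ∫⁻ x, ENNReal.ofReal ((z (ns k) x ^ 2 - 1) ^ 2) ∂(cellMeasure L))
              = fun k => ENNReal.ofReal (doubleWell L (z (ns k))) := by
            ext k
            exact (ofReal_integral_eq_lintegral_ofReal (integrable_doubleWell (hz _))
              (Eventually.of_forall fun _ => sq_nonneg _)).symm
          rw [this]
          exact ((ENNReal.continuous_ofReal.tendsto _).comp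
            (hℓ.comp hns.tendsto_atTop)).liminf_eq
  have hW : Integrable (fun x => (u x ^ 2 - 1) ^ 2) (cellMeasure L) := by
    refine ⟨hWm, ?_⟩
    rw [hasFiniteIntegral_iff_ofReal (Eventually.of_forall fun _ => sq_nonneg _)]
    exact hfat.trans_lt ENNReal.ofReal_lt_top
  refine ⟨memLp_four_of_integrable hum ?_, ?_⟩
  -- The double well controls the fourth power: `s⁴ ≤ 2 (s² - 1)² + 2`, with difference `(s² - 2)²`.
  · refine Integrable.mono' ((hW.const_mul 2).add (integrable_const 2))
      ((continuous_pow 4).comp_aestronglyMeasurable hum) (Eventually.of_forall fun x => ?_)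
    rw [Real.norm_eq_abs, abs_of_nonneg (by positivity)]
    simp only [Pi.add_apply]
    nlinarith [sq_nonneg (u x ^ 2 - 2)]
  · rw [← ofReal_integral_eq_lintegral_ofReal hW (Eventually.of_forall fun _ => sq_nonneg _)]
      at hfat
    exact (ENNReal.ofReal_le_ofReal_iff hℓ0).1 hfat

/-- The gradient and double-well terms are nonnegative; completing the square in `‖z - w‖` absorbs
the history term. -/
lemma energy_bddBelow (hb : 1 < b) : BddBelow (energy L ε b h w '' energySpace L) := by
  refine ⟨-(‖h‖ ^ 2 / (2 * b)), ?_⟩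
  rintro _ ⟨z, -, rfl⟩
  have h1 := gradInner_self_nonneg z
  have h2 := doubleWell_nonneg z
  have h3 : -(‖h‖ * ‖z - w‖) ≤ inner ℝ h (z - w) := (abs_le.1 (abs_real_inner_le_norm h (z - w))).1
  have h4 : 0 ≤ b / 2 * (‖z - w‖ - ‖h‖ / b) ^ 2 := by positivity
  have h5 : b / 2 * (‖z - w‖ - ‖h‖ / b) ^ 2
      = b / 2 * ‖z - w‖ ^ 2 - ‖h‖ * ‖z - w‖ + ‖h‖ ^ 2 / (2 * b) := by
    have : b ≠ 0 := by positivity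
    field_simp
    ring
  unfold energy
  have h6 : 0 ≤ ε ^ 2 / 2 * gradInner L z z := by positivity
  linarith

lemma exists_isMin_energy (hL : ∀ i, 0 < L i) (hε : 0 < ε) (hb : 1 < b) :
    ∃ u ∈ energySpace L, ∀ z ∈ energySpace L, energy L ε b h w u ≤ energy L ε b h w z := by
  set m := sInf (energy L ε b h w '' energySpace L) with hm
  have hmle : ∀ z ∈ energySpace L, m ≤ energy L ε b h w z := fun z hz =>
    csInf_le (energy_bddBelow hb) (mem_image_of_mem _ hz)
  have hex : ∀ n : ℕ, ∃ z ∈ energySpace L, energy L ε b h w z < m + 1 / (n + 1 : ℝ) := by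
    intro n
    obtain ⟨_, ⟨z, hz, rfl⟩, hlt⟩ := exists_lt_of_csInf_lt
      ((nonempty_of_mem zero_mem_energySpace).image (energy L ε b h w))
      (show m < m + 1 / (n + 1 : ℝ) from lt_add_of_pos_right _ Nat.one_div_pos_of_nat)
    exact ⟨z, hz, hlt⟩
  choose z hz hzm using hex
  -- The midpoint of two near-minimizers has energy at least `m`, so quantitative convexity bounds
  -- their distance by their energy gaps.
  have hconv : ∀ n k, convexityForm L ε b (z n - z k) ≤
      2 * (1 / (n + 1 : ℝ) + 1 / (k + 1 : ℝ)) := by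
    intro n k
    have h1 := energy_convexComb_le (ε := ε) (b := b) (h := h) (w := w) hL (hz n) (hz k)
      (s := 1 / 2) (r := 1 / 2) (by norm_num) (by norm_num) (by norm_num)
    have h2 := hmle _ (convex_energySpace (hz n) (hz k) (a := 1 / 2) (b := 1 / 2)
      (by norm_num) (by norm_num) (by norm_num))
    linarith [hzm n, hzm k]
  have hb' : 0 < b - 1 := by linarith
  obtain ⟨u, hu⟩ := cauchySeq_tendsto_of_complete (cauchySeq_of_sq_le (x := z)
    (c := (b - 1) / 4) (by positivity) fun n k => by
      have h1 := hconv n k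
      have h2 : 0 ≤ ε ^ 2 / 2 * gradInner L (z n - z k) (z n - z k) :=
        mul_nonneg (by positivity) (gradInner_self_nonneg _)
      unfold convexityForm at h1
      linarith)
  have hgrad : ∀ i, ∃ g, Tendsto (fun n => weakPartial L i (z n)) atTop (𝓝 g) := fun i =>
    cauchySeq_tendsto_of_complete (cauchySeq_of_sq_le
      (c := ε ^ 2 / 4) (by positivity) fun n k => by
        have h1 := hconv n k
        have h2 : 0 ≤ (b - 1) / 2 * ‖z n - z k‖ ^ 2 := by positivity
        have h3 : ‖weakPartial L i (z n) - weakPartial L i (z k)‖ ^ 2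
            ≤ gradInner L (z n - z k) (z n - z k) := by
          rw [← weakPartial_sub hL (hz n) (hz k), ← real_inner_self_eq_norm_sq]
          exact Finset.single_le_sum
            (f := fun i => inner ℝ (weakPartial L i (z n - z k)) (weakPartial L i (z n - z k)))
            (fun _ _ => real_inner_self_nonneg) (Finset.mem_univ i)
        have h4 := mul_le_mul_of_nonneg_left h3 (show 0 ≤ ε ^ 2 / 2 by positivity)
        unfold convexityForm at h1
        linarith)
  choose g hg using hgrad
  have hug : ∀ i, HasWeakPartial L i u (g i) := fun i =>
    HasWeakPartial.of_tendsto (fun n => hasWeakPartial_weakPartial (hz n) i) hu (hg i)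
  have hE : Tendsto (fun n => energy L ε b h w (z n)) atTop (𝓝 m) :=
    tendsto_of_tendsto_of_tendsto_of_le_of_le tendsto_const_nhds
      (by simpa using (tendsto_one_div_add_atTop_nhds_zero_nat (𝕜 := ℝ)).const_add m)
      (fun n => hmle _ (hz n)) (fun n => (hzm n).le)
  have hG : Tendsto (fun n => gradInner L (z n) (z n)) atTop (𝓝 (gradInner L u u)) := by
    unfold gradInner
    refine tendsto_finsetSum _ fun i _ => ?_
    rw [(hug i).weakPartial_eq hL]
    exact (hg i).inner (hg i)
  have hsub : Tendsto (fun n => z n - w) atTop (𝓝 (u - w)) := hu.sub_const w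
  have hQ : Tendsto (fun n => b / 2 * ‖z n - w‖ ^ 2 + inner ℝ h (z n - w)
      + ε ^ 2 / 2 * gradInner L (z n) (z n)) atTop
      (𝓝 (b / 2 * ‖u - w‖ ^ 2 + inner ℝ h (u - w) + ε ^ 2 / 2 * gradInner L u u)) :=
    (((hsub.norm.pow 2).const_mul _).add (tendsto_const_nhds.inner hsub)).add (hG.const_mul _)
  -- The total energies and the quadratic parts both converge, hence so do the double-well terms;
  -- their limit is four times `m` minus the quadratic part at `u`. Lower semicontinuity then puts
  -- the energy of `u` at or below `m`.
  have hW := (hE.sub hQ).const_mul 4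
  obtain ⟨hu4, hle⟩ := doubleWell_le_of_tendsto (fun n => (hz n).2) hu
    (hW.congr fun n => by
      unfold energy
      ring)
  refine ⟨u, ⟨fun i => ⟨g i, hug i⟩, hu4⟩, fun y hy => le_trans ?_ (hmle y hy)⟩
  unfold energy
  linarith

end Energy

/-! ### The kernels -/

lemma IsTimeGrid.tau_pos {T : ℝ} {N : ℕ} {t : ℕ → ℝ} (ht : IsTimeGrid T N t) {n : ℕ}
    (h1 : 1 ≤ n) (hn : n ≤ N) : 0 < tau t n := by
  obtain ⟨k, rfl⟩ := Nat.exists_eq_add_of_le' h1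
  simpa [tau] using ht.lt_succ k (by omega)

lemma IsTimeGrid.ratio_pos {T : ℝ} {N : ℕ} {t : ℕ → ℝ} (ht : IsTimeGrid T N t) {n : ℕ}
    (h1 : 2 ≤ n) (hn : n ≤ N) : 0 < ratio t n :=
  div_pos (ht.tau_pos (by omega) hn) (ht.tau_pos (by omega) (by omega))

/-- For `n ≥ 3` the factor `1 + r_{n-1}` cancels between the numerator and `kernelDenom`. -/
lemma kernel_zero_eq {T : ℝ} {N : ℕ} {t : ℕ → ℝ} (ht : IsTimeGrid T N t) {n : ℕ}
    (h1 : 1 ≤ n) (hn : n ≤ N) : kernel t n 0 = stepBound t n / tau t n := by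
  have hτ := ht.tau_pos h1 hn
  simp only [kernel, stepBound, if_true]
  split_ifs with hn1 hn2
  · subst hn1
    rfl
  · subst hn2
    have := ht.ratio_pos le_rfl hn
    field_simp
  · have h3 := ht.ratio_pos (n := n) (by omega) hn
    have h4 := ht.ratio_pos (n := n - 1) (by omega) (by omega)
    have h5 : 0 < 1 + ratio t (n - 1) + ratio t n * ratio t (n - 1) := by positivity
    rw [kernelDenom]
    field_simp

lemma tau_lt_stepBound_iff {T : ℝ} {N : ℕ} {t : ℕ → ℝ} (ht : IsTimeGrid T N t) {n : ℕ}
    (h1 : 1 ≤ n) (hn : n ≤ N) : tau t n < stepBound t n ↔ 1 < kernel t n 0 := by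
  rw [kernel_zero_eq ht h1 hn, one_lt_div (ht.tau_pos h1 hn)]

lemma D3_eq_add_history {E : Type*} [AddCommGroup E] [Module ℝ E] (t : ℕ → ℝ) (v : ℕ → E) {n : ℕ}
    (hn : 1 ≤ n) : D3 t v n = kernel t n 0 • (v n - v (n - 1)) + history t v n := by
  rw [D3, history, ← Finset.Ico_insert_right hn, Finset.sum_insert (by simp), Nat.sub_self, nabla]

lemma history_congr {E : Type*} [AddCommGroup E] [Module ℝ E] (t : ℕ → ℝ) {v w : ℕ → E} {n : ℕ}
    (h : ∀ k, k < n → v k = w k) : history t v n = history t w n := by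
  refine Finset.sum_congr rfl fun k hk => ?_
  rw [Finset.mem_Ico] at hk
  rw [nabla, nabla, h k hk.2, h (k - 1) (by omega)]

/-! ### Solutions of a single step -/

variable {ε : ℝ} {t : ℕ → ℝ} {n : ℕ}

lemma solvesAt_iff (hn : 1 ≤ n) (v : ℕ → L2 L) :
    SolvesAt L ε t v n ↔ v n ∈ energySpace L ∧ ∀ ψ ∈ energySpace L,
      weakForm L ε (kernel t n 0) (history t v n) (v (n - 1)) (v n) ψ = 0 := by
  rw [SolvesAt, D3_eq_add_history t v hn]
  rfl

lemma solvesAt_congr (hn : 1 ≤ n) {v w : ℕ → L2 L} (h : ∀ k, k ≤ n → v k = w k) :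
    SolvesAt L ε t v n ↔ SolvesAt L ε t w n := by
  rw [solvesAt_iff hn, solvesAt_iff hn, history_congr t fun k hk => h k hk.le, h n le_rfl,
    h (n - 1) (by omega)]

/-- Overwriting level `n` leaves the history and level `n - 1` unchanged; `1 ≤ n` ensures `n - 1 ≠
n` under truncated subtraction. -/
lemma solvesAt_update_iff (hn : 1 ≤ n) (v : ℕ → L2 L) (u : L2 L) :
    SolvesAt L ε t (Function.update v n u) n ↔ u ∈ energySpace L ∧ ∀ ψ ∈ energySpace L,
      weakForm L ε (kernel t n 0) (history t v n) (v (n - 1)) u ψ = 0 := by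
  rw [solvesAt_iff hn, history_congr t (w := v) fun k hk => Function.update_of_ne hk.ne _ _,
    Function.update_self, Function.update_of_ne (by omega)]

lemma solvesAt_update_iff_isMin (hL : ∀ i, 0 < L i) (hn : 1 ≤ n) (hb : 1 < kernel t n 0)
    (v : ℕ → L2 L) (u : L2 L) :
    SolvesAt L ε t (Function.update v n u) n ↔ u ∈ energySpace L ∧
      ∀ z ∈ energySpace L, z ≠ u → stepEnergy L ε t v n u < stepEnergy L ε t v n z := by
  rw [solvesAt_update_iff hn]
  exact and_congr_right fun hu => weakForm_eq_zero_iff_isMin hL hb hu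

lemma existsUnique_solvesAt_update (hL : ∀ i, 0 < L i) (hε : 0 < ε) (hn : 1 ≤ n)
    (hb : 1 < kernel t n 0) (v : ℕ → L2 L) :
    ∃! u, SolvesAt L ε t (Function.update v n u) n := by
  simp only [solvesAt_update_iff_isMin hL hn hb]
  obtain ⟨u, hu, hmin⟩ := exists_isMin_energy (h := history t v n) (w := v (n - 1)) hL hε hb
  have hstrict : ∀ z ∈ energySpace L, z ≠ u → stepEnergy L ε t v n u < stepEnergy L ε t v n z := by
    intro z hz hzu
    refine lt_of_le_of_ne (hmin z hz) fun heq => hzu ?_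
    -- A competitor of equal energy would also be a minimizer, contradicting strict convexity.
    exact (strictConvexOn_energy (ε := ε) (h := history t v n) (w := v (n - 1)) hL hb).eq_of_isMinOn
      (fun y hy => heq.symm.le.trans (hmin y hy)) hmin hz hu
  refine ⟨u, ⟨hu, hstrict⟩, fun y hy => ?_⟩
  by_contra hne
  exact lt_asymm (hstrict y hy.1 hne) (hy.2 u hu (Ne.symm hne))

/-- The definition of the weak derivative, tested with `∂_i φ`, which is again smooth and periodic.
-/
lemma integral_mul_laplacian (hL : ∀ i, 0 < L i) {u : L2 L} (hu : u ∈ energySpace L)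
    {φ : (Fin d → ℝ) → ℝ} (hφ : IsPeriodicTest L φ) :
    ∫ x in cell L, u x * ∑ i, partialDeriv i (partialDeriv i φ) x
      = -gradInner L u (testLp hφ) := by
  simp only [Finset.mul_sum]
  rw [integral_finsetSum, gradInner, ← Finset.sum_neg_distrib]
  · refine Finset.sum_congr rfl fun i _ => ?_
    rw [(hasWeakPartial_testLp hL hφ i).weakPartial_eq hL, inner_testLp]
    exact hasWeakPartial_weakPartial hu i _ (hφ.partialDeriv i)
  · exact fun i _ => (Lp.memLp u).integrable_mul
      (memLp_of_continuous ((hφ.partialDeriv i).partialDeriv i).smooth.continuous 2)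

lemma SolvesAt.solvesAEAt (hL : ∀ i, 0 < L i) (hε : 0 < ε) {v : ℕ → L2 L}
    (hv : SolvesAt L ε t v n) : SolvesAEAt L ε t v n := by
  have hD : Integrable (⇑(D3 t v n)) (cellMeasure L) :=
    (Lp.memLp (D3 t v n)).integrable (by norm_num)
  have hF : Integrable (fun x => bulkForce (v n x)) (cellMeasure L) := by
    simpa using integrable_bulkForce_mul hv.1.2 (memLp_const (1 : ℝ))
  -- The candidate Laplacian is read off from the equation, so the pointwise identity is algebra;
  -- the weak form shows that it is the distributional Laplacian.
  refine ⟨fun x => (ε ^ 2)⁻¹ * (D3 t v n x + bulkForce (v n x)),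
    ⟨(hD.add hF).const_mul _, fun φ hφ => ?_⟩, Eventually.of_forall fun x => ?_⟩
  · have h1 := hv.2 _ (testLp_mem_energySpace hL hφ)
    have h2 : ∫ x in cell L, bulkForce (v n x) * testLp hφ x
        = ∫ x in cell L, bulkForce (v n x) * φ x :=
      integral_congr_ae (by filter_upwards [coeFn_testLp hφ] with x hx; rw [hx])
    have h3 : ∫ x in cell L, (ε ^ 2)⁻¹ * (D3 t v n x + bulkForce (v n x)) * φ x
        = (ε ^ 2)⁻¹ * ((∫ x in cell L, D3 t v n x * φ x)
          + ∫ x in cell L, bulkForce (v n x) * φ x) := by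
      rw [← integral_add, ← integral_const_mul]
      · refine integral_congr_ae (Eventually.of_forall fun x => ?_)
        simp only
        ring
      · exact (Lp.memLp (D3 t v n)).integrable_mul (memLp_of_continuous hφ.smooth.continuous 2)
      · exact integrable_bulkForce_mul hv.1.2 (memLp_of_continuous hφ.smooth.continuous 4)
    rw [inner_testLp, h2] at h1
    rw [integral_mul_laplacian hL hv.1 hφ, h3]
    field_simp
    linarith
  · field_simp
    ring

/-! ### The whole scheme -/

lemma exists_solvesScheme {N : ℕ} {u₀ : L2 L}
    (h : ∀ n, 1 ≤ n → n ≤ N → ∀ v : ℕ → L2 L, ∃ u, SolvesAt L ε t (Function.update v n u) n) :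
    ∃ v, SolvesScheme L ε t N u₀ v := by
  induction N with
  | zero => exact ⟨fun _ => u₀, rfl, fun n h1 h2 => by omega⟩
  | succ N ih =>
    obtain ⟨v, hv0, hv⟩ := ih fun n h1 h2 => h n h1 (by omega)
    obtain ⟨u, hu⟩ := h (N + 1) (by omega) le_rfl v
    refine ⟨Function.update v (N + 1) u, ?_, fun n h1 h2 => ?_⟩
    · rw [Function.update_of_ne (by omega), hv0]
    · rcases h2.lt_or_eq with h3 | rfl
      · rw [solvesAt_congr h1 (w := v) fun k hk => Function.update_of_ne (by omega) _ _]
        exact hv n h1 (by omega)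
      · exact hu

lemma SolvesScheme.unique {N : ℕ} {u₀ : L2 L} {v w : ℕ → L2 L}
    (h : ∀ n, 1 ≤ n → n ≤ N → ∀ v : ℕ → L2 L, ∃! u, SolvesAt L ε t (Function.update v n u) n)
    (hv : SolvesScheme L ε t N u₀ v) (hw : SolvesScheme L ε t N u₀ w) {n : ℕ} (hn : n ≤ N) :
    w n = v n := by
  induction n using Nat.strong_induction_on with
  | _ n ih =>
    rcases Nat.eq_zero_or_pos n with rfl | h1
    · rw [hv.1, hw.1]
    -- By induction `w` agrees with `v` below `n`, so both `w n` and `v n` solve step `n` with the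
    -- history of `v`.
    · refine (h n h1 hn v).unique ?_ ?_
      · rw [solvesAt_congr h1 (w := w)]
        · exact hw.2 n h1 hn
        · intro k hk
          rcases hk.lt_or_eq with h2 | rfl
          · rw [Function.update_of_ne h2.ne, ih k h2 (by omega)]
          · rw [Function.update_self]
      · rw [Function.update_eq_self]
        exact hv.2 n h1 hn

end AllenCahnBDF3

end

theorem theorem4p1 (d : ℕ) (L : Fin d → ℝ) (hL : ∀ i, 0 < L i) (ε : ℝ) (hε : 0 < ε)
    (T : ℝ) (N : ℕ) (t : ℕ → ℝ) (ht : AllenCahnBDF3.IsTimeGrid T N t) :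
    -- the step-size condition is equivalent to `b_0^{(n)} > 1`
    (∀ n, 1 ≤ n → n ≤ N →
      (AllenCahnBDF3.tau t n < AllenCahnBDF3.stepBound t n ↔ 1 < AllenCahnBDF3.kernel t n 0)) ∧
    -- unique solvability of each single step, for arbitrary earlier levels `v 0, …, v (n - 1)`
    (∀ n, 1 ≤ n → n ≤ N → AllenCahnBDF3.tau t n < AllenCahnBDF3.stepBound t n →
      ∀ v : ℕ → AllenCahnBDF3.L2 L,
        (∃! u, AllenCahnBDF3.SolvesAt L ε t (Function.update v n u) n) ∧
        (∀ u, AllenCahnBDF3.SolvesAt L ε t (Function.update v n u) n →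
          AllenCahnBDF3.SolvesAEAt L ε t (Function.update v n u) n) ∧
        StrictConvexOn ℝ (AllenCahnBDF3.energySpace L) (AllenCahnBDF3.stepEnergy L ε t v n) ∧
        (∀ u, AllenCahnBDF3.SolvesAt L ε t (Function.update v n u) n ↔
          u ∈ AllenCahnBDF3.energySpace L ∧
            ∀ z ∈ AllenCahnBDF3.energySpace L, z ≠ u →
              AllenCahnBDF3.stepEnergy L ε t v n u < AllenCahnBDF3.stepEnergy L ε t v n z)) ∧
    -- unique solvability of the whole scheme
    ((∀ n, 1 ≤ n → n ≤ N → AllenCahnBDF3.tau t n < AllenCahnBDF3.stepBound t n) →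
      ∀ u₀ : AllenCahnBDF3.L2 L,
        ∃ v, AllenCahnBDF3.SolvesScheme L ε t N u₀ v ∧
          ∀ w, AllenCahnBDF3.SolvesScheme L ε t N u₀ w → ∀ n, n ≤ N → w n = v n) := by
  have hstep : ∀ n, 1 ≤ n → n ≤ N → AllenCahnBDF3.tau t n < AllenCahnBDF3.stepBound t n →
      1 < AllenCahnBDF3.kernel t n 0 := fun n h1 hn h =>
    (AllenCahnBDF3.tau_lt_stepBound_iff ht h1 hn).1 h
  refine ⟨fun n h1 hn => AllenCahnBDF3.tau_lt_stepBound_iff ht h1 hn,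
    fun n h1 hn hτ v => ⟨AllenCahnBDF3.existsUnique_solvesAt_update hL hε h1 (hstep n h1 hn hτ) v,
      fun u hu => hu.solvesAEAt hL hε, AllenCahnBDF3.strictConvexOn_energy hL (hstep n h1 hn hτ),
      AllenCahnBDF3.solvesAt_update_iff_isMin hL h1 (hstep n h1 hn hτ) v⟩,
    fun hτ u₀ => ?_⟩
  have huniq := fun n h1 hn (v : ℕ → AllenCahnBDF3.L2 L) =>
    AllenCahnBDF3.existsUnique_solvesAt_update hL hε h1 (hstep n h1 hn (hτ n h1 hn)) v
  obtain ⟨v, hv⟩ := AllenCahnBDF3.exists_solvesScheme (u₀ := u₀)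
    fun n h1 hn v => (huniq n h1 hn v).exists
  exact ⟨v, hv, fun w hw n hn => hv.unique huniq hw hn⟩
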